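/- Let $\mathscr{L}$ be the language with equality, no predicate symbols, a constant symbol $\mathbf{n}$ for every $n\in\mathbb{N}$, binary function symbols $+$, $\cdot$, $\delta$ and $\leq$, and a variadic function symbol $G$. Its terms are the constant symbols, the variables, $f(u,v)$ for a binary function symbol $f$ and terms $u,v$, $G(u_1,\ldots,u_n)$ for finitely many terms $u_1,\ldots,u_n$, and $G(u(\mathbf{0})\cdots_z u(v))$ for terms $u,v$ and a variable $z$; in the last term $z$ is bound in $u$ but not in $v$, so that its free variables are $(FV(u)\setminus\{z\})\cup FV(v)$. Write $r(z|t)$ for the result of substituting the term $t$ for the free occurrences of the variable $z$ in $r$ (a term or a formula). Let $\mathscr{M}$ be the model with universe $\mathbb{N}$ which interprets each $\mathbf{n}$ as $n$, interprets $+$ and $\cdot$ as addition and multiplication, and has $\delta^{\mathscr{M}}(m,n)=1$ if $m=n$ and $0$ otherwise; $\leq^{\mathscr{M}}(m,n)=1$ if $m\leq n$ and $0$ otherwise; and, for every finite sequence of naturals, $G^{\mathscr{M}}(m_1,\ldots,m_k)=1$ if some $m_i\neq 0$, and $0$ otherwise. Under an assignment $s$ of naturals to the variables, terms have values $t^s$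 defined as usual, with $G(u(\mathbf{0})\cdots_z u(v))^s=G^{\mathscr{M}}\bigl(u(z|\mathbf{0})^s,u(z|\mathbf{1})^s,\ldots,u(z|\overline{v^s})^s\bigr)$, where $\overline{k}$ is the constant symbol of $k$. First-order formulas and their truth in $\mathscr{M}$ are then defined as usual, and $\mathscr{M}\models\phi$ means that $\phi$ holds in $\mathscr{M}$ under every assignment. A formula is quantifier-free if it is built from equations between terms by $\wedge,\vee,\rightarrow,\leftrightarrow,\neg$. Let $x$ and $y$ be distinct variables. A set $X\subseteq\mathbb{N}$ is computably enumerable if and only if there is a quantifier-free $\mathscr{L}$-formula $\phi$, with free variables a subset of $\{x,y\}$, such that for all $n\in\mathbb{N}$, $$n\in X\iff\mathscr{M}\models\exists y\,\phi(x|\mathbf{n}).$$ -/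

import Mathlib

namespace Variadic

/-- The binary function symbols `+`, `·`, `δ`, `≤` of the language `L`. (`L` has no predicate
symbols, and `≤` is a function symbol.) -/
inductive BinSym : Type
  | add
  | mul
  | delta
  | le

/-- Terms of the language `L` with a constant symbol for every natural number, the binary function
symbols of `BinSym`, and one variadic function symbol `G`. Variables are named by natural
numbers. -/
inductive Term : Type
  /-- the constant symbol of the natural number `n` -/
  | const (n : ℕ) : Term
  /-- the variable `x` -/
  | var (x : ℕ) : Term
  /-- `f(u, v)` for a binary function symbol `f` -/
  | bin (f : BinSym) (u v : Term) : Term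
  /-- `G(u₁, …, uₙ)` -/
  | app (n : ℕ) (us : Fin n → Term) : Term
  /-- `G(u(0) ⋯_x u(v))`, which binds `x` in `u` and not in `v` -/
  | ellipsis (x : ℕ) (u v : Term) : Term

namespace Term

/-- The free variables of a term. -/
def freeVars : Term → Set ℕ
  | const _ => ∅
  | var x => {x}
  | bin _ u v => u.freeVars ∪ v.freeVars
  | app _ us => ⋃ i, (us i).freeVars
  | ellipsis x u v => (u.freeVars \ {x}) ∪ v.freeVars

/-- `r.subst x t` is the term `r(x|t)`. -/
def subst : (r : Term) → (x : ℕ) → (t : Term) → Term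
  | const n, _, _ => const n
  | var y, x, t => if y = x then t else var y
  | bin f u v, x, t => bin f (u.subst x t) (v.subst x t)
  | app n us, x, t => app n fun i => (us i).subst x t
  | ellipsis y u v, x, t =>
      if y = x then ellipsis y u (v.subst x t) else ellipsis y (u.subst x t) (v.subst x t)

/-- The depth of a term. -/
def depth : Term → ℕ
  | const _ => 0
  | var _ => 0
  | bin _ u v => max u.depth v.depth + 1
  | app _ us => (Finset.univ.sup fun i => (us i).depth) + 1
  | ellipsis _ u v => max u.depth v.depth + 1

theorem depth_subst_const (x k : ℕ) (t : Term) : (t.subst x (const k)).depth = t.depth := by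
  induction t with
  | const n => rfl
  | var y => by_cases h : y = x <;> simp [subst, depth, h]
  | bin f u v hu hv => simp [subst, depth, hu, hv]
  | app n us ih => simp [subst, depth, ih]
  | ellipsis y u v hu hv => by_cases h : y = x <;> simp [subst, depth, h, hu, hv]

end Term

/-- A structure for `L`: its universe is `ℕ`, the constant symbol of `n` denotes `n`, and what
remains to be given are the functions denoted by the other symbols. -/
structure Model : Type where
  bin : BinSym → ℕ → ℕ → ℕ
  G : List ℕ → ℕ

/-- The intended model of `L`. -/
def standardModel : Model where
  bin
    | .add => fun m n => m + n
    | .mul => fun m n => m * n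
    | .delta => fun m n => if m = n then 1 else 0
    | .le => fun m n => if m ≤ n then 1 else 0
  G l := if ∃ m ∈ l, m ≠ 0 then 1 else 0

namespace Term

/-- The interpretation `t^s` of the term `t` under the assignment `s`. The value of
`G(u(0) ⋯_x u(v))` is the value of the function `G` at the sequence
`u(x|0)^s, …, u(x|k)^s` where `k = v^s`. -/
def eval (M : Model) (s : ℕ → ℕ) : Term → ℕ
  | const n => n
  | var x => s x
  | bin f u v => M.bin f (eval M s u) (eval M s v)
  | app _ us => M.G (List.ofFn fun i => eval M s (us i))
  | ellipsis x u v =>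
      M.G ((List.range (eval M s v + 1)).map fun k => eval M s (u.subst x (const k)))
termination_by t => t.depth
decreasing_by
  · simp only [depth]; omega
  · simp only [depth]; omega
  · simp only [depth]
    exact Nat.lt_succ_of_le (Finset.le_sup (f := fun i => (us i).depth) (Finset.mem_univ i))
  · simp only [depth_subst_const, depth]; omega
  · simp only [depth]; omega

/-- The semantic interpretation `t_s`: the value of `G(u(0) ⋯_x u(v))` is the value of the
function `G` at the values of `u` under the assignments `s(x|0), …, s(x|k)` where `k = v_s`. -/
def evalSem (M : Model) : Term → (ℕ → ℕ) → ℕ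
  | const n, _ => n
  | var x, s => s x
  | bin f u v, s => M.bin f (u.evalSem M s) (v.evalSem M s)
  | app _ us, s => M.G (List.ofFn fun i => (us i).evalSem M s)
  | ellipsis x u v, s =>
      M.G ((List.range (v.evalSem M s + 1)).map fun k => u.evalSem M (Function.update s x k))

theorem evalSem_subst_const (M : Model) (x k : ℕ) (t : Term) (s : ℕ → ℕ) :
    (t.subst x (const k)).evalSem M s = t.evalSem M (Function.update s x k) := by
  induction t generalizing s with
  | const n => rfl
  | var y =>
    by_cases h : y = x
    · subst h; simp [subst, evalSem]
    · simp [subst, evalSem, h]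
  | bin f u v hu hv => simp [subst, evalSem, hu, hv]
  | app n us ih => simp [subst, evalSem, ih]
  | ellipsis y u v hu hv =>
    by_cases h : y = x
    · subst h; simp [subst, evalSem, hv]
    · simp [subst, evalSem, h, hu, hv, Function.update_comm h]

/-- The two interpretations of a term agree. -/
theorem eval_eq_evalSem (M : Model) (t : Term) (s : ℕ → ℕ) : t.eval M s = t.evalSem M s := by
  induction t using eval.induct with
  | case1 n => simp [eval, evalSem]
  | case2 x => simp [eval, evalSem]
  | case3 f u v hu hv => simp [eval, evalSem, hu, hv]
  | case4 n us ih => simp [eval, evalSem, ih]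
  | case5 x u v hu hv => simp [eval, evalSem, hv, hu, evalSem_subst_const]

end Term

/-- First-order formulas over `L`. -/
inductive Formula : Type
  | eq (u v : Term) : Formula
  | and (φ ψ : Formula) : Formula
  | or (φ ψ : Formula) : Formula
  | imp (φ ψ : Formula) : Formula
  | iff (φ ψ : Formula) : Formula
  | not (φ : Formula) : Formula
  | ex (x : ℕ) (φ : Formula) : Formula
  | all (x : ℕ) (φ : Formula) : Formula

namespace Formula

/-- The free variables of a formula. -/
def freeVars : Formula → Set ℕ
  | eq u v => u.freeVars ∪ v.freeVars
  | and φ ψ => φ.freeVars ∪ ψ.freeVars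
  | or φ ψ => φ.freeVars ∪ ψ.freeVars
  | imp φ ψ => φ.freeVars ∪ ψ.freeVars
  | iff φ ψ => φ.freeVars ∪ ψ.freeVars
  | not φ => φ.freeVars
  | ex x φ => φ.freeVars \ {x}
  | all x φ => φ.freeVars \ {x}

/-- `φ.subst x t` is the formula `φ(x|t)`. -/
def subst : (φ : Formula) → (x : ℕ) → (t : Term) → Formula
  | eq u v, x, t => eq (u.subst x t) (v.subst x t)
  | and φ ψ, x, t => and (φ.subst x t) (ψ.subst x t)
  | or φ ψ, x, t => or (φ.subst x t) (ψ.subst x t)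
  | imp φ ψ, x, t => imp (φ.subst x t) (ψ.subst x t)
  | iff φ ψ, x, t => iff (φ.subst x t) (ψ.subst x t)
  | not φ, x, t => not (φ.subst x t)
  | ex y φ, x, t => if y = x then ex y φ else ex y (φ.subst x t)
  | all y φ, x, t => if y = x then all y φ else all y (φ.subst x t)

/-- Quantifier-free formulas. -/
inductive QuantifierFree : Formula → Prop
  | eq (u v : Term) : QuantifierFree (eq u v)
  | and {φ ψ : Formula} : QuantifierFree φ → QuantifierFree ψ → QuantifierFree (and φ ψ)
  | or {φ ψ : Formula} : QuantifierFree φ → QuantifierFree ψ → QuantifierFree (or φ ψ)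
  | imp {φ ψ : Formula} : QuantifierFree φ → QuantifierFree ψ → QuantifierFree (imp φ ψ)
  | iff {φ ψ : Formula} : QuantifierFree φ → QuantifierFree ψ → QuantifierFree (iff φ ψ)
  | not {φ : Formula} : QuantifierFree φ → QuantifierFree (not φ)

end Formula

namespace Model

/-- `M.Sat φ s` is `M ⊨ φ[s]`. -/
def Sat (M : Model) : Formula → (ℕ → ℕ) → Prop
  | .eq u v, s => u.eval M s = v.eval M s
  | .and φ ψ, s => M.Sat φ s ∧ M.Sat ψ s
  | .or φ ψ, s => M.Sat φ s ∨ M.Sat ψ s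
  | .imp φ ψ, s => M.Sat φ s → M.Sat ψ s
  | .iff φ ψ, s => M.Sat φ s ↔ M.Sat ψ s
  | .not φ, s => ¬ M.Sat φ s
  | .ex x φ, s => ∃ n : ℕ, M.Sat φ (Function.update s x n)
  | .all x φ, s => ∀ n : ℕ, M.Sat φ (Function.update s x n)

/-- `M.Models φ` is `M ⊨ φ`: the formula `φ` holds in `M` under every assignment. -/
def Models (M : Model) (φ : Formula) : Prop :=
  ∀ s : ℕ → ℕ, M.Sat φ s

end Model

end Variadic

namespace Variadic

namespace Term

/-! A term is a bounded computation: an ellipsis runs over a finite range whose length is itself the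
value of a term. Hence the truth of a quantifier-free formula is primitive recursive in the
assignment (`primrecPred_sat`), and searching for `y` gives a computably enumerable set.

Conversely, on 0/1 values `G` is disjunction, so an ellipsis is a bounded existential quantifier
(`exists_le`). Together with `δ`, `≤` and products, this turns every bounded arithmetical condition
into an equation `t = 1`. One unbounded quantifier over such conditions (`Sigma1`) absorbs further
existential and bounded universal quantifiers. Gödel's β function then captures primitive recursion
(`sigma1_graph_of_primrec`), and Kleene's normal form captures all c.e. sets (`sigma1_of_rePred`).
-/

theorem evalSem_congr (M : Model) (t : Term) {s s' : ℕ → ℕ} (h : ∀ i ∈ t.freeVars, s i = s' i) :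
    t.evalSem M s = t.evalSem M s' := by
  induction t generalizing s s' with
  | const n => rfl
  | var x => exact h x rfl
  | bin f u v hu hv =>
    simp only [evalSem]
    rw [hu fun i hi => h i (Or.inl hi), hv fun i hi => h i (Or.inr hi)]
  | app n us ih =>
    simp only [evalSem]
    congr 2
    funext i
    exact ih i fun j hj => h j (Set.mem_iUnion.2 ⟨i, hj⟩)
  | ellipsis x u v hu hv =>
    simp only [evalSem]
    rw [hv fun i hi => h i (Or.inr hi)]
    congr 1
    refine List.map_congr_left fun k _ => hu fun i hi => ?_
    by_cases hix : i = x
    · simp [hix]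
    · simp [hix, h i (Or.inl ⟨hi, hix⟩)]

theorem finite_freeVars (t : Term) : t.freeVars.Finite := by
  induction t with
  | const n => exact Set.finite_empty
  | var x => exact Set.finite_singleton x
  | bin f u v hu hv => exact hu.union hv
  | app n us ih => exact Set.finite_iUnion ih
  | ellipsis x u v hu hv => exact hu.sdiff.union hv

end Term

namespace Model

theorem sat_congr (M : Model) (φ : Formula) {s s' : ℕ → ℕ}
    (h : ∀ i ∈ φ.freeVars, s i = s' i) : M.Sat φ s ↔ M.Sat φ s' := by
  induction φ generalizing s s' with
  | eq u v =>
    simp only [Sat, Term.eval_eq_evalSem]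
    rw [u.evalSem_congr M fun i hi => h i (Or.inl hi),
      v.evalSem_congr M fun i hi => h i (Or.inr hi)]
  | and φ ψ hφ hψ =>
    exact and_congr (hφ fun i hi => h i (Or.inl hi)) (hψ fun i hi => h i (Or.inr hi))
  | or φ ψ hφ hψ =>
    exact or_congr (hφ fun i hi => h i (Or.inl hi)) (hψ fun i hi => h i (Or.inr hi))
  | imp φ ψ hφ hψ =>
    exact imp_congr (hφ fun i hi => h i (Or.inl hi)) (hψ fun i hi => h i (Or.inr hi))
  | iff φ ψ hφ hψ =>
    exact iff_congr (hφ fun i hi => h i (Or.inl hi)) (hψ fun i hi => h i (Or.inr hi))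
  | not φ hφ => exact not_congr (hφ h)
  | ex x φ hφ =>
    refine exists_congr fun n => hφ fun i hi => ?_
    by_cases hix : i = x
    · simp [hix]
    · simp [hix, h i ⟨hi, hix⟩]
  | all x φ hφ =>
    refine forall_congr' fun n => hφ fun i hi => ?_
    by_cases hix : i = x
    · simp [hix]
    · simp [hix, h i ⟨hi, hix⟩]

theorem sat_subst_const (M : Model) (φ : Formula) (x k : ℕ) (s : ℕ → ℕ) :
    M.Sat (φ.subst x (.const k)) s ↔ M.Sat φ (Function.update s x k) := by
  induction φ generalizing s with
  | eq u v => simp [Formula.subst, Sat, Term.eval_eq_evalSem, Term.evalSem_subst_const]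
  | and φ ψ hφ hψ => simp [Formula.subst, Sat, hφ, hψ]
  | or φ ψ hφ hψ => simp [Formula.subst, Sat, hφ, hψ]
  | imp φ ψ hφ hψ => simp [Formula.subst, Sat, hφ, hψ]
  | iff φ ψ hφ hψ => simp [Formula.subst, Sat, hφ, hψ]
  | not φ hφ => simp [Formula.subst, Sat, hφ]
  | ex y φ hφ =>
    by_cases h : y = x
    · subst h; simp [Formula.subst, Sat]
    · simp [Formula.subst, Sat, h, hφ, Function.update_comm h]
  | all y φ hφ =>
    by_cases h : y = x
    · subst h; simp [Formula.subst, Sat]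
    · simp [Formula.subst, Sat, h, hφ, Function.update_comm h]

/-- For a formula in the variables `x` and `y`, the assignment of the other variables is
irrelevant. -/
theorem models_ex_subst_const (M : Model) {φ : Formula} {x y : ℕ} (hxy : x ≠ y)
    (hφ : φ.freeVars ⊆ {x, y}) (n : ℕ) :
    M.Models (.ex y (φ.subst x (.const n))) ↔
      ∃ m, M.Sat φ (Function.update (fun _ => m) x n) := by
  -- Off `x` the assignment can be constantly `m`, which makes it an explicit function of `n` and
  -- `m`.
  have key (s : ℕ → ℕ) (m : ℕ) : M.Sat (φ.subst x (.const n)) (Function.update s y m) ↔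
      M.Sat φ (Function.update (fun _ => m) x n) := by
    rw [sat_subst_const]
    refine sat_congr M φ fun i hi => ?_
    rcases hφ hi with rfl | rfl
    · simp
    · simp [hxy.symm]
  exact ⟨fun h => (h fun _ => 0).imp fun m hm => (key _ m).1 hm,
    fun h s => h.imp fun m hm => (key s m).2 hm⟩

end Model

/-! ### Primitive recursiveness of quantifier-free truth -/

section Computability

theorem primrec_standardModel_bin (f : BinSym) : Primrec₂ (standardModel.bin f) := by
  cases f with
  | add => exact Primrec.nat_add
  | mul => exact Primrec.nat_mul
  | delta => exact Primrec.ite Primrec.eq (Primrec.const 1) (Primrec.const 0)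
  | le => exact Primrec.ite Primrec.nat_le (Primrec.const 1) (Primrec.const 0)

theorem primrec_standardModel_G : Primrec standardModel.G := by
  have h : PrimrecPred fun m : ℕ => m ≠ 0 :=
    (Primrec.eq.comp Primrec.id (Primrec.const 0)).not
  exact Primrec.ite h.exists_mem_list (Primrec.const 1) (Primrec.const 0)

/-- The parameter type varies in the induction: under an ellipsis the value of the bound variable
becomes an extra parameter, in `α × ℕ`. -/
theorem Term.primrec_evalSem (t : Term) {α : Type} [Primcodable α] {σ : α → ℕ → ℕ}
    (hσ : ∀ i, Primrec fun a => σ a i) : Primrec fun a => t.evalSem standardModel (σ a) := by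
  induction t generalizing α with
  | const n => exact Primrec.const n
  | var x => exact hσ x
  | bin f u v hu hv => exact (primrec_standardModel_bin f).comp (hu hσ) (hv hσ)
  | app n us ih => exact primrec_standardModel_G.comp (Primrec.list_ofFn fun i => ih i hσ)
  | ellipsis x u v hu hv =>
    refine primrec_standardModel_G.comp (Primrec.list_map
      (Primrec.list_range.comp (Primrec.succ.comp (hv hσ))) ?_)
    refine hu (σ := fun p : α × ℕ => Function.update (σ p.1) x p.2) fun i => ?_
    by_cases h : i = x
    · subst h
      simpa using Primrec.snd
    · simpa [h] using (hσ i).comp Primrec.fst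

theorem Formula.QuantifierFree.primrecPred_sat {φ : Formula} (hφ : φ.QuantifierFree) {α : Type}
    [Primcodable α] {σ : α → ℕ → ℕ} (hσ : ∀ i, Primrec fun a => σ a i) :
    PrimrecPred fun a => standardModel.Sat φ (σ a) := by
  induction hφ with
  | eq u v =>
    simp only [Model.Sat, Term.eval_eq_evalSem]
    exact Primrec.eq.comp (u.primrec_evalSem hσ) (v.primrec_evalSem hσ)
  | and _ _ hu hv => exact hu.and hv
  | or _ _ hu hv => exact hu.or hv
  | imp _ _ hu hv => exact (hu.not.or hv).of_eq fun a => imp_iff_not_or.symm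
  | iff _ _ hu hv =>
    exact ((hu.and hv).or (hu.not.and hv.not)).of_eq fun a => iff_iff_and_or_not_and_not.symm
  | not _ hu => exact hu.not

theorem rePred_exists {R : ℕ → ℕ → Prop} (hR : PrimrecPred fun p : ℕ × ℕ => R p.1 p.2) :
    REPred fun n => ∃ m, R n m := by
  classical
  have hd := hR.computablePred.decide
  have := (Partrec.rfind (p := fun n m => Part.some (decide (R n m))) hd.partrec).dom_re
  refine this.of_eq fun n => Nat.rfind_dom.trans (exists_congr fun m => ?_)
  simp

end Computability

/-! ### Conditions whose indicator function is a term -/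

section Definability

theorem standardModel_G (l : List ℕ) : standardModel.G l = if ∃ m ∈ l, m ≠ 0 then 1 else 0 := rfl

/-- Values of `f` at values of terms are values of terms, without new free variables. -/
def DefinableFn {n : ℕ} (f : (Fin n → ℕ) → ℕ) : Prop :=
  ∀ ρ : Fin n → Term, ∃ t : Term, t.freeVars ⊆ ⋃ i, (ρ i).freeVars ∧
    ∀ s, t.evalSem standardModel s = f fun i => (ρ i).evalSem standardModel s

open Classical in
/-- The indicator function of `P` is given by a term. -/
def DefinablePred {n : ℕ} (P : (Fin n → ℕ) → Prop) : Prop :=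
  DefinableFn fun v => if P v then 1 else 0

namespace DefinableFn

variable {m n : ℕ} {f g : (Fin n → ℕ) → ℕ}

theorem const (k : ℕ) : DefinableFn fun _ : Fin n → ℕ => k :=
  fun _ => ⟨.const k, Set.empty_subset _, fun _ => rfl⟩

theorem proj (i : Fin n) : DefinableFn fun v => v i :=
  fun ρ => ⟨ρ i, Set.subset_iUnion (fun i => (ρ i).freeVars) i, fun _ => rfl⟩

theorem bin (b : BinSym) (hf : DefinableFn f) (hg : DefinableFn g) :
    DefinableFn fun v => standardModel.bin b (f v) (g v) := by
  intro ρ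
  obtain ⟨t, ht, ht'⟩ := hf ρ
  obtain ⟨u, hu, hu'⟩ := hg ρ
  exact ⟨.bin b t u, Set.union_subset ht hu, fun s => by simp only [Term.evalSem, ht', hu']⟩

theorem add (hf : DefinableFn f) (hg : DefinableFn g) : DefinableFn fun v => f v + g v :=
  bin .add hf hg

theorem mul (hf : DefinableFn f) (hg : DefinableFn g) : DefinableFn fun v => f v * g v :=
  bin .mul hf hg

/-- Since definability is asked at arbitrary argument terms, composition needs no substitution into
terms, and variable capture never arises. -/
theorem comp {h : (Fin m → ℕ) → ℕ} (hh : DefinableFn h) {g : Fin m → (Fin n → ℕ) → ℕ}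
    (hg : ∀ i, DefinableFn (g i)) : DefinableFn fun v => h fun i => g i v := by
  intro ρ
  choose ts hts hts' using fun i => hg i ρ
  obtain ⟨t, ht, ht'⟩ := hh ts
  exact ⟨t, ht.trans (Set.iUnion_subset hts), fun s => by simp only [ht', hts']⟩

end DefinableFn

namespace DefinablePred

variable {m n : ℕ} {f g : (Fin n → ℕ) → ℕ} {P Q : (Fin n → ℕ) → Prop}

theorem of_iff (hP : DefinablePred P) (h : ∀ v, P v ↔ Q v) : DefinablePred Q :=
  (funext fun v => propext (h v) : P = Q) ▸ hP

theorem eq (hf : DefinableFn f) (hg : DefinableFn g) : DefinablePred fun v => f v = g v := by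
  have := hf.bin .delta hg
  simp only [standardModel] at this
  unfold DefinablePred
  convert this

theorem le (hf : DefinableFn f) (hg : DefinableFn g) : DefinablePred fun v => f v ≤ g v := by
  have := hf.bin .le hg
  simp only [standardModel] at this
  unfold DefinablePred
  convert this

theorem lt (hf : DefinableFn f) (hg : DefinableFn g) : DefinablePred fun v => f v < g v :=
  le (hf.add (.const 1)) hg

theorem and (hP : DefinablePred P) (hQ : DefinablePred Q) :
    DefinablePred fun v => P v ∧ Q v := by
  unfold DefinablePred
  convert DefinableFn.mul hP hQ using 2 with v
  by_cases P v <;> by_cases Q v <;> simp [*]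

theorem not (hP : DefinablePred P) : DefinablePred fun v => ¬ P v :=
  (eq hP (.const 0)).of_iff fun v => by simp

theorem or (hP : DefinablePred P) (hQ : DefinablePred Q) :
    DefinablePred fun v => P v ∨ Q v :=
  (hP.not.and hQ.not).not.of_iff fun v => by tauto

theorem comp {R : (Fin m → ℕ) → Prop} (hR : DefinablePred R) {g : Fin m → (Fin n → ℕ) → ℕ}
    (hg : ∀ i, DefinableFn (g i)) : DefinablePred fun v => R fun i => g i v :=
  DefinableFn.comp hR hg

/-- `G` applied to the indicators of `R` at `0, …, f v` is their disjunction, and an ellipsis is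
exactly such an application. -/
theorem exists_le {R : (Fin (n + 1) → ℕ) → Prop} (hR : DefinablePred R) (hf : DefinableFn f) :
    DefinablePred fun v => ∃ k ≤ f v, R (Matrix.vecCons k v) := by
  classical
  intro ρ
  -- The bound variable `z` must be fresh for every `ρ i`, so that varying it leaves the arguments
  -- unchanged.
  obtain ⟨z, hz⟩ := (Set.finite_iUnion fun i => (ρ i).finite_freeVars).infinite_compl.nonempty
  have hz' (i) : z ∉ (ρ i).freeVars := fun h => hz (Set.mem_iUnion.2 ⟨i, h⟩)
  obtain ⟨t, ht, ht'⟩ := hf ρ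
  obtain ⟨u, hu, hu'⟩ := hR (Matrix.vecCons (.var z) ρ)
  have key (s : ℕ → ℕ) (k : ℕ) : (fun i => (Matrix.vecCons (Term.var z) ρ i).evalSem standardModel
      (Function.update s z k)) =
      Matrix.vecCons k fun i => (ρ i).evalSem standardModel s := by
    funext i
    refine Fin.cases ?_ (fun i => ?_) i
    · simp [Term.evalSem]
    · simp only [Matrix.cons_val_succ]
      refine Term.evalSem_congr _ _ fun j hj => Function.update_of_ne ?_ _ _
      rintro rfl
      exact hz' i hj
  refine ⟨.ellipsis z u t, Set.union_subset ?_ ht, fun s => ?_⟩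
  · rintro i ⟨hi, hiz⟩
    obtain ⟨j, hj⟩ := Set.mem_iUnion.1 (hu hi)
    revert hj
    refine Fin.cases (fun hj => absurd hj hiz) (fun j hj => ?_) j
    exact Set.mem_iUnion.2 ⟨j, by simpa using hj⟩
  · have hu'' (k : ℕ) : u.evalSem standardModel (Function.update s z k) =
        if R (Matrix.vecCons k fun i => (ρ i).evalSem standardModel s) then 1 else 0 := by
      rw [hu', key]
    simp only [Term.evalSem, hu'', ht', standardModel_G]
    refine @if_congr _ _ _ _ (_) _ _ _ _ ?_ rfl rfl
    simp

theorem forall_le {R : (Fin (n + 1) → ℕ) → Prop} (hR : DefinablePred R) (hf : DefinableFn f) :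
    DefinablePred fun v => ∀ k ≤ f v, R (Matrix.vecCons k v) :=
  (hR.not.exists_le hf).not.of_iff fun v => by simp

/-- `Nat.pair` is a polynomial on each side of the test `g v < h v`. -/
theorem eq_pair {h : (Fin n → ℕ) → ℕ} (hf : DefinableFn f) (hg : DefinableFn g)
    (hh : DefinableFn h) : DefinablePred fun v => f v = Nat.pair (g v) (h v) := by
  refine (((lt hg hh).and (eq hf ((hh.mul hh).add hg))).or
    ((lt hg hh).not.and (eq hf (((hg.mul hg).add hg).add hh)))).of_iff fun v => ?_
  unfold Nat.pair
  split_ifs with hlt <;> simp [hlt]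

/-- The graph of Gödel's β function, as a function of two codes and an index. -/
theorem eq_mod {c d i : (Fin n → ℕ) → ℕ} (hf : DefinableFn f) (hc : DefinableFn c)
    (hd : DefinableFn d) (hi : DefinableFn i) :
    DefinablePred fun v => f v = c v % ((i v + 1) * d v + 1) := by
  -- The coordinates are remainder, `c`, `d`, `i`. The quotient never exceeds the dividend, so its
  -- quantifier is bounded.
  have h : DefinablePred fun w : Fin 4 → ℕ =>
      w 0 < (w 3 + 1) * w 2 + 1 ∧
        ∃ q ≤ w 1, w 1 = q * ((w 3 + 1) * w 2 + 1) + w 0 := by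
    refine (lt (.proj 0) ((((DefinableFn.proj 3).add (.const 1)).mul (.proj 2)).add
      (.const 1))).and (exists_le (R := fun w : Fin 5 → ℕ =>
        w 2 = w 0 * ((w 4 + 1) * w 3 + 1) + w 1) ?_ (.proj 1))
    exact eq (.proj 2) (((DefinableFn.proj 0).mul ((((DefinableFn.proj 4).add (.const 1)).mul
      (.proj 3)).add (.const 1))).add (.proj 1))
  refine (h.comp (g := ![f, c, d, i]) ?_).of_iff fun v => ?_
  · intro j
    fin_cases j
    exacts [hf, hc, hd, hi]
  · change (f v < (i v + 1) * d v + 1 ∧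
        ∃ q ≤ c v, c v = q * ((i v + 1) * d v + 1) + f v) ↔ _
    generalize hb : (i v + 1) * d v + 1 = b
    have hb0 : 0 < b := by omega
    constructor
    · rintro ⟨hlt, q, -, hq⟩
      rw [hq, Nat.mul_add_mod', Nat.mod_eq_of_lt hlt]
    · intro h
      rw [h]
      exact ⟨Nat.mod_lt _ hb0, c v / b, Nat.div_le_self _ _, (Nat.div_add_mod' _ _).symm⟩

end DefinablePred

/-! ### Closure properties of Σ₁ predicates -/

/-- Existential quantifications of definable predicates. -/
def Sigma1 {n : ℕ} (S : (Fin n → ℕ) → Prop) : Prop :=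
  ∃ P : (Fin (n + 1) → ℕ) → Prop, DefinablePred P ∧ ∀ v, S v ↔ ∃ y, P (Matrix.vecCons y v)

theorem DefinablePred.sigma1 {n : ℕ} {P : (Fin n → ℕ) → Prop} (hP : DefinablePred P) :
    Sigma1 P :=
  ⟨fun w => P fun i => w i.succ, hP.comp fun i => .proj i.succ, fun v => by simp⟩

namespace Sigma1

variable {m n : ℕ} {f : (Fin n → ℕ) → ℕ} {S T : (Fin n → ℕ) → Prop}

theorem of_iff (hS : Sigma1 S) (h : ∀ v, S v ↔ T v) : Sigma1 T :=
  (funext fun v => propext (h v) : S = T) ▸ hS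

theorem comp {R : (Fin m → ℕ) → Prop} (hR : Sigma1 R) {g : Fin m → (Fin n → ℕ) → ℕ}
    (hg : ∀ i, DefinableFn (g i)) : Sigma1 fun v => R fun i => g i v := by
  obtain ⟨P, hP, h⟩ := hR
  refine ⟨fun w => P (Matrix.vecCons (w 0) fun i => g i fun j => w j.succ), ?_, fun v => ?_⟩
  · refine (hP.comp (g := Matrix.vecCons (fun w => w 0) fun i w => g i fun j => w j.succ)
      ?_).of_iff fun w => ?_
    · intro i
      refine Fin.cases ?_ (fun i => ?_) i
      · exact .proj 0
      · exact (hg i).comp fun j => .proj j.succ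
    · refine iff_of_eq (congrArg P ?_)
      funext i
      refine Fin.cases ?_ (fun i => ?_) i <;> simp
  · simp [h]

/-- Two unbounded witnesses are traded for one common bound, below which both are sought. -/
theorem exists_nat {R : (Fin (n + 1) → ℕ) → Prop} (hR : Sigma1 R) :
    Sigma1 fun v => ∃ k, R (Matrix.vecCons k v) := by
  obtain ⟨P, hP, h⟩ := hR
  have h1 : DefinablePred fun w : Fin (n + 1) → ℕ => ∃ k ≤ w 0, ∃ y ≤ w 0,
      P (Matrix.vecCons y (Matrix.vecCons k fun i => w i.succ)) := by
    refine DefinablePred.exists_le (R := fun w : Fin (n + 2) → ℕ => ∃ y ≤ w 1,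
      P (Matrix.vecCons y (Matrix.vecCons (w 0) fun i => w i.succ.succ))) ?_ (.proj 0)
    refine DefinablePred.exists_le (R := fun w : Fin (n + 3) → ℕ =>
      P (Matrix.vecCons (w 0) (Matrix.vecCons (w 1) fun i => w i.succ.succ.succ))) ?_ (.proj 1)
    refine (hP.comp (g := fun i w => Matrix.vecCons (w 0) (Matrix.vecCons (w 1)
      fun i => w i.succ.succ.succ) i) fun i => ?_).of_iff fun w => Iff.rfl
    refine Fin.cases (.proj 0) (fun i => ?_) i
    refine Fin.cases (.proj 1) (fun i => ?_) i
    exact .proj i.succ.succ.succ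
  refine ⟨_, h1, fun v => ?_⟩
  simp only [h, Matrix.cons_val_zero, Matrix.cons_val_succ]
  constructor
  · rintro ⟨k, y, hy⟩
    exact ⟨max k y, k, le_max_left _ _, y, le_max_right _ _, hy⟩
  · rintro ⟨_, k, _, y, _, hy⟩
    exact ⟨k, y, hy⟩

theorem and (hS : Sigma1 S) (hT : Sigma1 T) : Sigma1 fun v => S v ∧ T v := by
  obtain ⟨P, hP, h⟩ := hS
  obtain ⟨Q, hQ, h'⟩ := hT
  have h1 : Sigma1 fun v => ∃ y, ∃ z, P (Matrix.vecCons y v) ∧ Q (Matrix.vecCons z v) := by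
    refine exists_nat (R := fun w : Fin (n + 1) → ℕ => ∃ z, P w ∧
      Q (Matrix.vecCons z fun i => w i.succ)) (exists_nat (R := fun w : Fin (n + 2) → ℕ =>
        P (fun i => w i.succ) ∧ Q (Matrix.vecCons (w 0) fun i => w i.succ.succ))
        (DefinablePred.sigma1 ?_))
    refine (hP.comp fun i => .proj i.succ).and ?_
    refine (hQ.comp (g := fun i w => Matrix.vecCons (w 0) (fun i => w i.succ.succ) i)
      fun i => ?_).of_iff fun w => Iff.rfl
    exact Fin.cases (.proj 0) (fun i => .proj i.succ.succ) i
  refine h1.of_iff fun v => ?_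
  rw [h, h']
  simp

theorem forall_lt {R : (Fin (n + 1) → ℕ) → Prop} (hR : Sigma1 R) (hf : DefinableFn f) :
    Sigma1 fun v => ∀ k < f v, R (Matrix.vecCons k v) := by
  obtain ⟨P, hP, h⟩ := hR
  -- The ellipsis includes its upper end, so `k < f` reappears as a premise.
  have h1 : DefinablePred fun w : Fin (n + 1) → ℕ => ∀ k ≤ f (fun i => w i.succ),
      k < f (fun i => w i.succ) → ∃ y ≤ w 0,
        P (Matrix.vecCons y (Matrix.vecCons k fun i => w i.succ)) := by
    refine DefinablePred.forall_le (R := fun w : Fin (n + 2) → ℕ =>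
      w 0 < f (fun i => w i.succ.succ) → ∃ y ≤ w 1,
        P (Matrix.vecCons y (Matrix.vecCons (w 0) fun i => w i.succ.succ))) ?_
      (hf.comp fun i => .proj i.succ)
    refine ((DefinablePred.lt (.proj 0) (hf.comp fun i => .proj i.succ.succ)).not.or
      (DefinablePred.exists_le (R := fun w : Fin (n + 3) → ℕ =>
        P (Matrix.vecCons (w 0) (Matrix.vecCons (w 1) fun i => w i.succ.succ.succ)))
        ?_ (.proj 1))).of_iff fun w => imp_iff_not_or.symm
    refine (hP.comp (g := fun i w => Matrix.vecCons (w 0) (Matrix.vecCons (w 1)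
      fun i => w i.succ.succ.succ) i) fun i => ?_).of_iff fun w => Iff.rfl
    refine Fin.cases (.proj 0) (fun i => ?_) i
    refine Fin.cases (.proj 1) (fun i => ?_) i
    exact .proj i.succ.succ.succ
  refine ⟨_, h1, fun v => ?_⟩
  simp only [h, Matrix.cons_val_zero, Matrix.cons_val_succ]
  constructor
  · intro H
    choose! y hy using H
    -- Collection: finitely many `k` need witnesses, so one number bounds them all.
    refine ⟨(Finset.range (f v)).sup y, fun k _ hk => ⟨y k, ?_, hy k hk⟩⟩
    exact Finset.le_sup (Finset.mem_range.2 hk)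
  · rintro ⟨_, H⟩ k hk
    obtain ⟨y, -, hy⟩ := H k hk.le hk
    exact ⟨y, hy⟩

end Sigma1

/-! ### Primitive recursion and c.e. sets -/

/-- Values of a primitive recursion are witnessed by two parameters of Gödel's β function. -/
theorem natRec_eq_iff_exists_mod (a : ℕ) (g : ℕ → ℕ → ℕ) (k m : ℕ) :
    (Nat.rec a g k : ℕ) = m ↔ ∃ c d : ℕ, a = c % ((0 + 1) * d + 1) ∧
      m = c % ((k + 1) * d + 1) ∧
      ∀ i < k, ∃ z w : ℕ, z = c % ((i + 1) * d + 1) ∧ w = c % ((i + 1 + 1) * d + 1) ∧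
        g i z = w := by
  constructor
  · rintro rfl
    let F : ℕ → ℕ := fun j => Nat.rec a g j
    -- The whole history `F 0, …, F k` is encoded; `Nat.unbeta` packs the two β parameters into one
    -- pair.
    let l : List ℕ := (List.range (k + 1)).map F
    have key (i : ℕ) (hi : i ≤ k) :
        F i = (Nat.unbeta l).unpair.1 % ((i + 1) * (Nat.unbeta l).unpair.2 + 1) := by
      have := Nat.beta_unbeta_coe l ⟨i, by simp [l]; omega⟩
      rw [Nat.beta] at this
      rw [this]
      simp [l]
    refine ⟨_, _, key 0 (Nat.zero_le _), key k le_rfl, fun i hi =>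
      ⟨_, _, key i hi.le, key (i + 1) hi, rfl⟩⟩
  · rintro ⟨c, d, h0, hk, H⟩
    have key (i : ℕ) (hi : i ≤ k) : (Nat.rec a g i : ℕ) = c % ((i + 1) * d + 1) := by
      induction i with
      | zero => exact h0
      | succ i ih =>
        obtain ⟨z, w, hz, hw, hzw⟩ := H i hi
        rw [← hw, ← hzw, hz, ← ih (by omega)]
    rw [hk]
    exact key k le_rfl

theorem sigma1_graph_of_primrec {f : ℕ → ℕ} (hf : Nat.Primrec f) :
    Sigma1 fun v : Fin 2 → ℕ => f (v 0) = v 1 := by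
  induction hf with
  | zero => exact (DefinablePred.eq (.const 0) (.proj 1)).sigma1
  | succ => exact (DefinablePred.eq ((DefinableFn.proj 0).add (.const 1)) (.proj 1)).sigma1
  | left =>
    have : DefinablePred fun v : Fin 3 → ℕ => v 1 = Nat.pair (v 2) (v 0) :=
      .eq_pair (.proj 1) (.proj 2) (.proj 0)
    refine this.sigma1.exists_nat.of_iff fun v => ?_
    change (∃ k, v 0 = Nat.pair (v 1) k) ↔ _
    constructor
    · rintro ⟨k, hk⟩
      simp [hk]
    · intro h
      exact ⟨(v 0).unpair.2, by rw [← h, Nat.pair_unpair]⟩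
  | right =>
    have : DefinablePred fun v : Fin 3 → ℕ => v 1 = Nat.pair (v 0) (v 2) :=
      .eq_pair (.proj 1) (.proj 0) (.proj 2)
    refine this.sigma1.exists_nat.of_iff fun v => ?_
    change (∃ k, v 0 = Nat.pair k (v 1)) ↔ _
    constructor
    · rintro ⟨k, hk⟩
      simp [hk]
    · intro h
      exact ⟨(v 0).unpair.1, by rw [← h, Nat.pair_unpair]⟩
  | @pair f g _ _ hf hg =>
    have hp : DefinablePred fun v : Fin 4 → ℕ => v 3 = Nat.pair (v 1) (v 0) :=
      .eq_pair (.proj 3) (.proj 1) (.proj 0)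
    have h1 := hf.comp (n := 4) (g := ![fun v => v 2, fun v => v 1]) fun i => by
      fin_cases i
      exacts [.proj 2, .proj 1]
    have h2 := hg.comp (n := 4) (g := ![fun v => v 2, fun v => v 0]) fun i => by
      fin_cases i
      exacts [.proj 2, .proj 0]
    refine ((h1.and h2).and hp.sigma1).exists_nat.exists_nat.of_iff fun v => ?_
    change (∃ a b, (f (v 0) = a ∧ g (v 0) = b) ∧ v 1 = Nat.pair a b) ↔ _
    constructor
    · rintro ⟨_, _, ⟨rfl, rfl⟩, h⟩
      exact h.symm
    · intro h
      exact ⟨_, _, ⟨rfl, rfl⟩, h.symm⟩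
  | @comp f g _ _ hf hg =>
    have h1 := hg.comp (n := 3) (g := ![fun v => v 1, fun v => v 0]) fun i => by
      fin_cases i
      exacts [.proj 1, .proj 0]
    have h2 := hf.comp (n := 3) (g := ![fun v => v 0, fun v => v 2]) fun i => by
      fin_cases i
      exacts [.proj 0, .proj 2]
    refine (h1.and h2).exists_nat.of_iff fun v => ?_
    change (∃ a, g (v 0) = a ∧ f a = v 1) ↔ _
    simp
  | @prec f g _ _ hf hg =>
    -- The coordinates are `i, c, d, k, a`: loop index, β parameters, recursion length, fixed
    -- argument. Each `exists_nat` binds coordinate 0, so inner predicates see these shifted.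
    have step : Sigma1 fun w : Fin 5 → ℕ => ∃ z u : ℕ, z = w 1 % ((w 0 + 1) * w 2 + 1) ∧
        u = w 1 % ((w 0 + 1 + 1) * w 2 + 1) ∧ g (Nat.pair (w 4) (Nat.pair (w 0) z)) = u := by
      have hg' : Sigma1 fun w : Fin 7 → ℕ =>
          ∃ p q : ℕ, p = Nat.pair (w 2) (w 1) ∧ q = Nat.pair (w 6) p ∧ g q = w 0 := by
        have h1 := hg.comp (n := 9) (g := ![fun v => v 0, fun v => v 2]) fun i => by
          fin_cases i
          exacts [.proj 0, .proj 2]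
        exact (((DefinablePred.eq_pair (n := 9) (.proj 1) (.proj 4) (.proj 3)).sigma1).and
          ((DefinablePred.eq_pair (n := 9) (.proj 0) (.proj 8) (.proj 1)).sigma1.and
            h1)).exists_nat.exists_nat
      have h2 := ((DefinablePred.eq_mod (n := 7) (.proj 1) (.proj 3) (.proj 4) (.proj 2)).sigma1.and
        ((DefinablePred.eq_mod (n := 7) (.proj 0) (.proj 3) (.proj 4)
          ((DefinableFn.proj 2).add (.const 1))).sigma1.and hg')).exists_nat.exists_nat
      refine h2.of_iff fun w => ?_
      change (∃ z u : ℕ, z = w 1 % ((w 0 + 1) * w 2 + 1) ∧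
        u = w 1 % ((w 0 + 1 + 1) * w 2 + 1) ∧ ∃ p q : ℕ, p = Nat.pair (w 0) z ∧
          q = Nat.pair (w 4) p ∧ g q = u) ↔ _
      simp
    -- The coordinates are `c, d, k, a`, the initial value `e = f a`, then the input `v 0` and the
    -- output `v 1`.
    have loop : Sigma1 fun w : Fin 7 → ℕ => ∀ i < w 2, ∃ z u : ℕ, z = w 0 % ((i + 1) * w 1 + 1) ∧
        u = w 0 % ((i + 1 + 1) * w 1 + 1) ∧ g (Nat.pair (w 3) (Nat.pair i z)) = u := by
      refine (step.comp (n := 8) (g := ![fun w => w 0, fun w => w 1, fun w => w 2, fun w => w 3,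
        fun w => w 4]) fun i => ?_).forall_lt (.proj 2)
      fin_cases i
      exacts [.proj 0, .proj 1, .proj 2, .proj 3, .proj 4]
    have base := hf.comp (n := 7) (g := ![fun v => v 3, fun v => v 4]) fun i => by
      fin_cases i
      exacts [.proj 3, .proj 4]
    have h1 := (((DefinablePred.eq_pair (n := 7) (.proj 5) (.proj 3) (.proj 2)).sigma1.and base).and
      ((DefinablePred.eq_mod (n := 7) (.proj 4) (.proj 0) (.proj 1) (.const 0)).sigma1.and
        ((DefinablePred.eq_mod (n := 7) (.proj 6) (.proj 0) (.proj 1) (.proj 2)).sigma1.and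
          loop))).exists_nat.exists_nat.exists_nat.exists_nat.exists_nat
    refine h1.of_iff fun v => ?_
    change (∃ e a k d c : ℕ, (v 0 = Nat.pair a k ∧ f a = e) ∧ e = c % ((0 + 1) * d + 1) ∧
      v 1 = c % ((k + 1) * d + 1) ∧ ∀ i < k, ∃ z u : ℕ, z = c % ((i + 1) * d + 1) ∧
        u = c % ((i + 1 + 1) * d + 1) ∧ g (Nat.pair a (Nat.pair i z)) = u) ↔ _
    simp only [Nat.unpaired]
    rw [natRec_eq_iff_exists_mod (f (v 0).unpair.1)
      (fun i z => g (Nat.pair (v 0).unpair.1 (Nat.pair i z)))]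
    constructor
    · rintro ⟨_, a, k, d, c, ⟨h, rfl⟩, H⟩
      rw [h, Nat.unpair_pair]
      exact ⟨c, d, H⟩
    · rintro ⟨c, d, H⟩
      exact ⟨_, _, _, d, c, ⟨(Nat.pair_unpair _).symm, rfl⟩, H⟩

/-- Kleene's normal form: `p n` holds when some code halts on `n` within some number `k` of steps,
and the step-bounded evaluator `evaln` is primitive recursive. -/
theorem sigma1_of_rePred {p : ℕ → Prop} (hp : REPred p) : Sigma1 fun v : Fin 1 → ℕ => p (v 0) := by
  obtain ⟨c, hc⟩ := Nat.Partrec.Code.exists_code.1 (Partrec.nat_iff.1 (hp.map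
    ((Computable.const 0).to₂ : Computable₂ fun (_ : ℕ) (_ : Unit) => (0 : ℕ))))
  -- `none` is encoded by `0` and `some` by a successor, so `m + 1` expresses halting.
  have hdom (n : ℕ) : p n ↔ ∃ k m, Encodable.encode (c.evaln k n) = m + 1 := by
    have h1 : p n ↔ (c.eval n).Dom := by
      rw [hc]
      simp [Part.assert]
    rw [h1, Part.dom_iff_mem]
    simp only [Nat.Partrec.Code.evaln_complete, Option.mem_def]
    rw [exists_comm]
    refine exists_congr fun k => ?_
    cases c.evaln k n <;> simp
  have hprim : Nat.Primrec fun n => Encodable.encode (c.evaln n.unpair.2 n.unpair.1) := by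
    refine Primrec.nat_iff.1 (Primrec.encode.comp (Nat.Partrec.Code.primrec_evaln.comp
      (((Primrec.snd.comp Primrec.unpair).pair (Primrec.const c)).pair
        (Primrec.fst.comp Primrec.unpair))))
  have h1 := (sigma1_graph_of_primrec hprim).comp (n := 4)
    (g := ![fun v => v 0, fun v => v 1 + 1]) fun i => by
      fin_cases i
      exacts [.proj 0, (DefinableFn.proj 1).add (.const 1)]
  have h2 := ((DefinablePred.eq_pair (n := 4) (.proj 0) (.proj 3) (.proj 2)).sigma1.and
    h1).exists_nat.exists_nat.exists_nat
  refine h2.of_iff fun v => ?_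
  rw [hdom]
  change (∃ k m q, q = Nat.pair (v 0) k ∧
    Encodable.encode (c.evaln q.unpair.2 q.unpair.1) = m + 1) ↔ _
  simp

end Definability

end Variadic

theorem mainTheorem6 (x y : ℕ) (hxy : x ≠ y) (X : Set ℕ) :
    REPred (fun n : ℕ => n ∈ X) ↔
      ∃ φ : Variadic.Formula, φ.QuantifierFree ∧ φ.freeVars ⊆ {x, y} ∧
        ∀ n : ℕ, n ∈ X ↔
          Variadic.standardModel.Models (.ex y (φ.subst x (.const n))) := by
  classical
  constructor
  · intro hX
    obtain ⟨P, hP, h⟩ := Variadic.sigma1_of_rePred hX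
    -- `y` comes first because `Sigma1` prepends its witness to the arguments.
    obtain ⟨t, ht, ht'⟩ := hP ![.var y, .var x]
    have hφ : (Variadic.Formula.eq t (.const 1)).freeVars ⊆ {x, y} := by
      refine Set.union_subset (ht.trans (Set.iUnion_subset fun i => ?_)) (Set.empty_subset _)
      fin_cases i <;> simp [Variadic.Term.freeVars]
    refine ⟨_, .eq _ _, hφ, fun n => ?_⟩
    rw [Variadic.Model.models_ex_subst_const _ hxy hφ]
    refine (h ![n]).trans (exists_congr fun m => ?_)
    simp only [Variadic.Model.Sat, Variadic.Term.eval_eq_evalSem, ht', Variadic.Term.evalSem]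
    have : (fun i => (![Variadic.Term.var y, .var x] i).evalSem Variadic.standardModel
        (Function.update (fun _ => m) x n)) = ![m, n] := by
      funext i
      fin_cases i <;> simp [Variadic.Term.evalSem, hxy.symm]
    rw [this]
    simp
  · rintro ⟨φ, hqf, hφ, h⟩
    have hprim : PrimrecPred fun p : ℕ × ℕ => Variadic.standardModel.Sat φ
        (Function.update (fun _ => p.2) x p.1) := by
      refine hqf.primrecPred_sat fun i => ?_
      by_cases hi : i = x
      · subst hi
        simpa using Primrec.fst
      · simpa [hi] using Primrec.snd
    refine (Variadic.rePred_exists (R := fun n m => Variadic.standardModel.Sat φ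
      (Function.update (fun _ => m) x n)) hprim).of_eq fun n => ?_
    rw [h, Variadic.Model.models_ex_subst_const _ hxy hφ]
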